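/- Consider a finite stochastic game with public monitoring: a nonempty finite set $I$ of players, a nonempty finite set $S$ of states, a finite set $Y$ of public signals, a nonempty finite action set $B$ common to all players, stage payoffs $u_i(a,s)$, and for each state $s$ and action profile $a\in B^I$ a probability distribution $p(\cdot,\cdot\mid s,a)$ on $S\times Y$ of the next state and the public signal; this last object is the monitoring structure $\Pi$. Both $u$ and $p$ are extended multilinearly to mixed actions. The game is symmetric: for every permutation $\tau$ of $I$, $u_{\tau(i)}(a\circ\tau^{-1},s)=u_i(a,s)$ and $p(\cdot,\cdot\mid s,a\circ\tau^{-1})=p(\cdot,\cdot\mid s,a)$. Players maximize expected average discounted payoffs with discount factor $\delta\in(0,1)$. A public history is a sequence $(s^1,y^1,s^2,\dots,y^{k-1},s^k)$ of past states and signals together with the current state. A strongly symmetric equilibrium (SSE) of the game with initial state $s$ is a profile of public strategies whose continuation after every public history starting at $s$ is a Nash equilibrium and in which all players use the same mixed action after every such history. Let $E^\delta_{SS}(s)\subseteq\mathbb R$ be the set of (common) SSE payoffs with initial state $s$. For $\lambda\in\{-1,+1\}$ let $k_{SS}(\lambda;\Pi)\in[-\infty,+\infty]$ be the supremum (with $\sup\emptyset=-\infty$)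 of $\lambda v$ over all $\alpha=(\alpha_s)_{s\in S}\in\Delta(B)^S$, $v\in\mathbb R$ and $x_s(t,y)\in\mathbb R$ $(s,t\in S,\ y\in Y)$ such that, writing $(\alpha_s)$ for the profile in which all players use $\alpha_s$, - $v=u_i((\alpha_s),s)+\sum_{(t,y)}x_s(t,y)\,p(t,y\mid s,(\alpha_s))$ for all $s\in S$, $i\in I$; - $v\ge u_i((b,(\alpha_s)_{-i}),s)+\sum_{(t,y)}x_s(t,y)\,p(t,y\mid s,(b,(\alpha_s)_{-i}))$ for all $s\in S$, $i\in I$, $b\in B$; - $\lambda\sum_{s\in T}x_s(\xi(s),\psi(s))\le 0$ for every $T\subseteq S$, every permutation $\xi$ of $T$ and every $\psi:T\to Y$. Then: 1. For every $\delta\in(0,1)$, $\ \bigcap_{s\in S}E^\delta_{SS}(s)\subseteq[-k_{SS}(-1;\Pi),\,k_{SS}(+1;\Pi)]$. 2. For all real $\underline z\le\bar z$ with $-k_{SS}(-1;\Pi)<\underline z$ and $\bar z<k_{SS}(+1;\Pi)$ there is $\bar\delta\in(0,1)$ such that $[\underline z,\bar z]\subseteq E^\delta_{SS}(s)$ for all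 $s\in S$ and all $\delta\in[\bar\delta,1)$. Both statements also hold with $E^\delta_{SS}(s)$ replaced by the set of payoffs of SSE in pure strategies, and $k_{SS}(\lambda;\Pi)$ replaced by the analogous supremum in which every $\alpha_s$ is required to be a pure action. -/

import Mathlib

noncomputable section

/-- A finite stochastic game with public monitoring in which every player `i : I` has the same
action set `B`. States are `S`, public signals are `Y`; `u i s a` is the stage payoff of player
`i` at state `s` under the action profile `a`, and `p s a (t, y)` is the probability that the next
state is `t` and the public signal is `y`. -/
structure StochasticGame (I S B Y : Type*) [Fintype S] [Fintype Y] where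
  u : I → S → (I → B) → ℝ
  p : S → (I → B) → S × Y → ℝ
  p_nonneg : ∀ s a ty, 0 ≤ p s a ty
  p_sum : ∀ s a, ∑ ty, p s a ty = 1

/-- Mixed actions: probability vectors on `B`. -/
abbrev MixedAction (B : Type*) [Fintype B] : Type _ := stdSimplex ℝ B

/-- The degenerate mixed action that plays `b` for sure. -/
def pureAction {B : Type*} [Fintype B] [DecidableEq B] (b : B) : MixedAction B :=
  ⟨Pi.single b 1, single_mem_stdSimplex ℝ b⟩

/-- A (behavior) strategy in the game with a given initial state: it selects a mixed action after
every private history, the chronological list of (own action, public signal, next state). -/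
abbrev Strategy (S B Y : Type*) [Fintype B] : Type _ := List (B × Y × S) → MixedAction B

/-- A public strategy in the game with a given initial state: it selects a mixed action after every
public history, the chronological list of (public signal, next state). -/
abbrev PublicStrategy (S B Y : Type*) [Fintype B] : Type _ := List (Y × S) → MixedAction B

namespace PublicStrategy

variable {S B Y : Type*} [Fintype B]

/-- A public strategy as a strategy that ignores the player's own past actions. -/
def toStrategy (σ : PublicStrategy S B Y) : Strategy S B Y := fun l => σ (l.map Prod.snd)

/-- The continuation of a public strategy after the public history `h`. -/
def after (σ : PublicStrategy S B Y) (h : List (Y × S)) : PublicStrategy S B Y :=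
  fun l => σ (h ++ l)

end PublicStrategy

/-- The current state after the public history `h`, when the initial state is `s`. -/
def currentState {S Y : Type*} (s : S) (h : List (Y × S)) : S :=
  (h.getLast?.map Prod.snd).getD s

namespace StochasticGame

variable {I S B Y : Type*} [Fintype I] [DecidableEq I] [Fintype S] [Fintype B] [Fintype Y]

/-- Symmetry: relabelling the players by any permutation relabels the payoffs accordingly and does
not affect the distribution of the next state and the signal. (In `a ∘ τ.symm`, player `τ i` plays
what player `i` plays in `a`.) -/
def IsSymmetric (G : StochasticGame I S B Y) : Prop :=
  ∀ (τ : Equiv.Perm I) (s : S) (a : I → B),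
    (∀ i, G.u (τ i) s (a ∘ τ.symm) = G.u i s a) ∧ G.p s (a ∘ τ.symm) = G.p s a

/-- Expected stage payoff under a profile of independent mixed actions. -/
def uMix (G : StochasticGame I S B Y) (i : I) (s : S) (α : I → MixedAction B) : ℝ :=
  ∑ a : I → B, (∏ j, (α j : B → ℝ) (a j)) * G.u i s a

/-- Distribution of next state and signal under a profile of independent mixed actions. -/
def pMix (G : StochasticGame I S B Y) (s : S) (α : I → MixedAction B) (ty : S × Y) : ℝ :=
  ∑ a : I → B, (∏ j, (α j : B → ℝ) (a j)) * G.p s a ty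

/-- `G.expStage i k s σ` is the expectation of the stage payoff of player `i` received `k` periods
after the start of the game with initial state `s`, when the profile `σ` is played. -/
def expStage (G : StochasticGame I S B Y) (i : I) : ℕ → S → (I → Strategy S B Y) → ℝ
  | 0, s, σ => G.uMix i s (fun j => σ j [])
  | k + 1, s, σ =>
      ∑ a : I → B, (∏ j, (σ j [] : B → ℝ) (a j)) *
        ∑ ty : S × Y, G.p s a ty *
          G.expStage i k ty.1 (fun j l => σ j ((a j, ty.2, ty.1) :: l))

/-- Average discounted expected payoff of player `i` in the game with initial state `s`. -/
def payoff (G : StochasticGame I S B Y) (δ : ℝ) (i : I) (s : S) (σ : I → Strategy S B Y) : ℝ :=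
  (1 - δ) * ∑' k : ℕ, δ ^ k * G.expStage i k s σ

/-- Nash equilibrium of the game with initial state `s`. -/
def IsNash (G : StochasticGame I S B Y) (δ : ℝ) (s : S) (σ : I → Strategy S B Y) : Prop :=
  ∀ (i : I) (τ : Strategy S B Y), G.payoff δ i s (Function.update σ i τ) ≤ G.payoff δ i s σ

/-- Perfect public equilibrium of the game with initial state `s`: a profile of public strategies
whose continuation after every public history is a Nash equilibrium. -/
def IsPPE (G : StochasticGame I S B Y) (δ : ℝ) (s : S) (σ : I → PublicStrategy S B Y) : Prop :=
  ∀ h : List (Y × S),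
    G.IsNash δ (currentState s h) (fun i => ((σ i).after h).toStrategy)

/-- Strongly symmetric equilibrium: a perfect public equilibrium in which all players choose the
same mixed action after every public history. -/
def IsSSE (G : StochasticGame I S B Y) (δ : ℝ) (s : S) (σ : I → PublicStrategy S B Y) : Prop :=
  G.IsPPE δ s σ ∧ ∀ i j h, σ i h = σ j h

/-- The set of (common) payoffs of strongly symmetric equilibria with initial state `s`. -/
def sseSet (G : StochasticGame I S B Y) (δ : ℝ) (s : S) : Set ℝ :=
  {v | ∃ σ : I → PublicStrategy S B Y, G.IsSSE δ s σ ∧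
    ∀ i, G.payoff δ i s (fun j => (σ j).toStrategy) = v}

variable [DecidableEq B]

/-- The set of payoffs of pure-strategy strongly symmetric equilibria with initial state `s`. -/
def pureSseSet (G : StochasticGame I S B Y) (δ : ℝ) (s : S) : Set ℝ :=
  {v | ∃ σ : I → PublicStrategy S B Y, G.IsSSE δ s σ ∧ (∀ i h, ∃ b, σ i h = pureAction b) ∧
    ∀ i, G.payoff δ i s (fun j => (σ j).toStrategy) = v}

/-- Feasibility of `(α, v, x)` in the score maximization problem in direction `l`
(`l = 1` or `l = -1`), where `α s` is the mixed action common to all players at state `s` and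
`x s t y` is the transfer at state `s` when the next state is `t` and the signal is `y`. -/
structure Feasible (G : StochasticGame I S B Y) (l : ℝ) (α : S → MixedAction B) (v : ℝ)
    (x : S → S → Y → ℝ) : Prop where
  value : ∀ s i, v = G.uMix i s (fun _ => α s) +
    ∑ ty : S × Y, x s ty.1 ty.2 * G.pMix s (fun _ => α s) ty
  incentive : ∀ s i b, G.uMix i s (Function.update (fun _ => α s) i (pureAction b)) +
    ∑ ty : S × Y, x s ty.1 ty.2 *
      G.pMix s (Function.update (fun _ => α s) i (pureAction b)) ty ≤ v
  cycle : ∀ (T : Finset S) (ξ : Equiv.Perm T) (ψ : T → Y),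
    l * ∑ s : T, x s (ξ s) (ψ s) ≤ 0

/-- The score in direction `l`: the supremum of `l * v` over the feasible `(α, v, x)`
(`-∞` if there is none). -/
def kSS (G : StochasticGame I S B Y) (l : ℝ) : EReal :=
  sSup {r | ∃ α v x, G.Feasible l α v x ∧ r = ((l * v : ℝ) : EReal)}

/-- The score in direction `l` when the actions `α s` are required to be pure. -/
def kSSPure (G : StochasticGame I S B Y) (l : ℝ) : EReal :=
  sSup {r | ∃ (a : S → B) (v : ℝ) (x : S → S → Y → ℝ),
    G.Feasible l (fun s => pureAction (a s)) v x ∧ r = ((l * v : ℝ) : EReal)}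

end StochasticGame

end

/-!
An equilibrium payoff is enforced by continuation payoffs that are again equilibrium payoffs, and
conversely, by the one-shot deviation principle, every bounded family of payoff sets that generates
itself in this way consists of equilibrium payoffs (Abreu, Pearce and Stacchetti).

For the upper bound, choose at each state `s` an equilibrium payoff `z s` that almost maximizes
`l * z` and rewrite the continuation payoffs enforcing it as transfers around a payoff common to all
states. Writing `W s` for the supremum, the transfers from `s` to `t` are at most proportional to
`W t - W s`, so their sums over cycles telescope.

For the lower bound, transfers whose sums over cycles are nonpositive are bounded by differences of
a potential. Use them, scaled by `(1 - δ) / δ`, to update a promised payoff, switching between the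
solution in direction `1` and the one in direction `-1` before the promise leaves the interval on
the wrong side. The promise corrected by the potential drifts back towards the interval, so it
exceeds the interval only by a multiple of `(1 - δ) / δ`, which for patient players keeps it below
the score.
-/

noncomputable section

open Function Filter Topology

section MixedProfiles

variable {I B : Type*} [Fintype I] [DecidableEq I] [Fintype B]

/-- The expectation of a function of the action profile when the players randomize independently
according to `α`, as a linear functional. -/
def mixExp (α : I → MixedAction B) : ((I → B) → ℝ) →ₗ[ℝ] ℝ where
  toFun F := ∑ a : I → B, (∏ j, (α j : B → ℝ) (a j)) * F a
  map_add' F F' := by simp only [Pi.add_apply, mul_add, Finset.sum_add_distrib]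
  map_smul' c F := by
    simp only [Pi.smul_apply, smul_eq_mul, RingHom.id_apply, Finset.mul_sum, mul_left_comm c]

theorem mixExp_apply (α : I → MixedAction B) (F : (I → B) → ℝ) :
    mixExp α F = ∑ a : I → B, (∏ j, (α j : B → ℝ) (a j)) * F a := rfl

theorem mixExp_const (α : I → MixedAction B) (c : ℝ) : mixExp α (fun _ => c) = c := by
  have total_weight : ∑ a : I → B, ∏ j, (α j : B → ℝ) (a j) = 1 := by
    rw [← Fintype.prod_sum]
    exact Finset.prod_eq_one fun j _ => (α j).2.2
  rw [mixExp_apply, ← Finset.sum_mul, total_weight, one_mul]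

theorem mixExp_mono (α : I → MixedAction B) : Monotone (mixExp α) := fun _ _ h =>
  Finset.sum_le_sum fun a _ =>
    mul_le_mul_of_nonneg_left (h a) (Finset.prod_nonneg fun j _ => (α j).2.1 (a j))

theorem abs_mixExp_le (α : I → MixedAction B) {F : (I → B) → ℝ} {M : ℝ} (h : ∀ a, |F a| ≤ M) :
    |mixExp α F| ≤ M := by
  refine abs_le.2 ⟨?_, ?_⟩
  · exact (mixExp_const α (-M)).ge.trans (mixExp_mono α fun a => (abs_le.1 (h a)).1)
  · exact (mixExp_mono α fun a => (abs_le.1 (h a)).2).trans (mixExp_const α M).le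

theorem hasSum_mixExp {κ : Type*} (α : I → MixedAction B) {f : κ → (I → B) → ℝ}
    {F : (I → B) → ℝ} (h : ∀ a, HasSum (fun k => f k a) (F a)) :
    HasSum (fun k => mixExp α (f k)) (mixExp α F) :=
  hasSum_sum fun a _ => (h a).mul_left _

theorem mixExp_comp_perm (α : I → MixedAction B) (τ : Equiv.Perm I) (F : (I → B) → ℝ) :
    mixExp (α ∘ τ.symm) F = mixExp α fun a => F (a ∘ τ.symm) := by
  refine (Fintype.sum_equiv (Equiv.arrowCongr τ (Equiv.refl B)) _ _ fun a => ?_).symm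
  exact congrArg (· * F (a ∘ τ.symm))
    (Equiv.prod_comp τ.symm fun k => (α k : B → ℝ) (a k)).symm

variable [DecidableEq B]

theorem mixExp_update (α : I → MixedAction B) (i : I) (β : MixedAction B) (F : (I → B) → ℝ) :
    mixExp (update α i β) F = ∑ b, (β : B → ℝ) b * mixExp (update α i (pureAction b)) F := by
  have weight_update (γ : MixedAction B) (a : I → B) :
      ∏ j, (update α i γ j : B → ℝ) (a j) =
        (γ : B → ℝ) (a i) * ∏ j ∈ Finset.univ \ {i}, (α j : B → ℝ) (a j) := by
    simp only [apply_update (fun j (γ : MixedAction B) => (γ : B → ℝ) (a j)),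
      Finset.prod_update_of_mem (Finset.mem_univ i)]
  simp only [mixExp_apply, weight_update, Finset.mul_sum]
  rw [Finset.sum_comm]
  refine Finset.sum_congr rfl fun a _ => ?_
  rw [Finset.sum_eq_single (a i) (fun b _ hb => by simp [pureAction, hb.symm]) (by simp)]
  simp [pureAction, mul_assoc]

theorem mixExp_update_le (α : I → MixedAction B) (i : I) (β : MixedAction B) {F : (I → B) → ℝ}
    {c : ℝ} (h : ∀ b, mixExp (update α i (pureAction b)) F ≤ c) :
    mixExp (update α i β) F ≤ c := by
  calc mixExp (update α i β) F
      = ∑ b, (β : B → ℝ) b * mixExp (update α i (pureAction b)) F := mixExp_update α i β F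
    _ ≤ ∑ b, (β : B → ℝ) b * c :=
        Finset.sum_le_sum fun b _ => mul_le_mul_of_nonneg_left (h b) (β.2.1 b)
    _ = c := by rw [← Finset.sum_mul, show ∑ b, (β : B → ℝ) b = 1 from β.2.2, one_mul]

end MixedProfiles

section Histories

variable {I S B Y : Type*}

theorem currentState_append_singleton (s : S) (h : List (Y × S)) (o : Y × S) :
    currentState s (h ++ [o]) = o.2 := by
  simp [currentState]

theorem currentState_append (s : S) (h h' : List (Y × S)) :
    currentState s (h ++ h') = currentState (currentState s h) h' := by
  rcases List.eq_nil_or_concat h' with rfl | ⟨l, o, rfl⟩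
  · simp [currentState]
  · rw [List.concat_eq_append, ← List.append_assoc, currentState_append_singleton,
      currentState_append_singleton]

theorem foldl_eq_currentState {Q : Type*} {f : Q → S} {next : Q → Y × S → Q}
    (hnext : ∀ q o, f (next q o) = o.2) (q : Q) (h : List (Y × S)) :
    f (h.foldl next q) = currentState (f q) h := by
  rcases List.eq_nil_or_concat h with rfl | ⟨l, o, rfl⟩
  · simp [currentState]
  · simp only [List.concat_eq_append, List.foldl_concat, hnext, currentState_append_singleton]

variable [Fintype B]

/-- The profile that follows `σ` after the first-period actions `a` and the next state and signal
`ty`. -/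
def nextProfile (σ : I → Strategy S B Y) (a : I → B) (ty : S × Y) : I → Strategy S B Y :=
  fun j l => σ j ((a j, ty.2, ty.1) :: l)

theorem nextProfile_update [DecidableEq I] (σ : I → Strategy S B Y) (i : I) (τ : Strategy S B Y)
    (a : I → B) (ty : S × Y) :
    nextProfile (update σ i τ) a ty =
      update (nextProfile σ a ty) i fun l => τ ((a i, ty.2, ty.1) :: l) :=
  funext fun j => apply_update (fun j τ l => τ ((a j, ty.2, ty.1) :: l)) σ i τ j

/-- The profile of continuations of a public profile after the public history `h`, as strategies
that may be compared with deviations depending on private histories. -/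
def profileAfter (σ : I → PublicStrategy S B Y) (h : List (Y × S)) : I → Strategy S B Y :=
  fun j => ((σ j).after h).toStrategy

theorem profileAfter_nil (σ : I → PublicStrategy S B Y) :
    profileAfter σ [] = fun j => (σ j).toStrategy := rfl

theorem profileAfter_apply_nil (σ : I → PublicStrategy S B Y) (h : List (Y × S)) (j : I) :
    profileAfter σ h j [] = σ j h := by
  simp [profileAfter, PublicStrategy.toStrategy, PublicStrategy.after]

theorem profileAfter_after (σ : I → PublicStrategy S B Y) (h h' : List (Y × S)) :
    profileAfter (fun j => (σ j).after h) h' = profileAfter σ (h ++ h') := by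
  funext j l
  simp [profileAfter, PublicStrategy.toStrategy, PublicStrategy.after]

theorem nextProfile_profileAfter (σ : I → PublicStrategy S B Y) (h : List (Y × S)) (a : I → B)
    (ty : S × Y) : nextProfile (profileAfter σ h) a ty = profileAfter σ (h ++ [(ty.2, ty.1)]) := by
  funext j l
  simp [nextProfile, profileAfter, PublicStrategy.toStrategy, PublicStrategy.after]

end Histories

section Discounting

theorem nonpos_of_forall_le_imp_le_mul {ι : Type*} {g : ι → ℝ} {δ : ℝ} (hδ : δ < 1)
    (hg : BddAbove (Set.range g)) (hstep : ∀ M, (∀ x, g x ≤ M) → ∀ x, g x ≤ δ * M) (x : ι) :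
    g x ≤ 0 := by
  have : Nonempty ι := ⟨x⟩
  have hsup : ⨆ y, g y ≤ δ * ⨆ y, g y := ciSup_le (hstep _ (le_ciSup hg))
  have hsup_nonpos : ⨆ y, g y ≤ 0 := by nlinarith
  exact (le_ciSup hg x).trans hsup_nonpos

end Discounting

namespace StochasticGame

section OneShot

variable {I S B Y : Type*} [Fintype S] [Fintype Y]

/-- The payoff of player `i` at the action profile `a` in the one-shot game at state `s` in which
the stage payoff has weight `1 - δ` and the continuation payoff `w t y`, earned when the next state
is `t` and the signal is `y`, has weight `δ`. -/
def oneShot (G : StochasticGame I S B Y) (δ : ℝ) (i : I) (s : S) (w : S → Y → ℝ) (a : I → B) : ℝ :=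
  (1 - δ) * G.u i s a + δ * ∑ ty : S × Y, G.p s a ty * w ty.1 ty.2

theorem oneShot_mono (G : StochasticGame I S B Y) {δ : ℝ} (hδ : 0 ≤ δ) (i : I) (s : S) (a : I → B)
    {w w' : S → Y → ℝ} (h : ∀ t y, w t y ≤ w' t y) :
    G.oneShot δ i s w a ≤ G.oneShot δ i s w' a := by
  have := G.p_nonneg s a
  unfold oneShot
  gcongr
  · exact this _
  · exact h _ _

variable [Fintype I] [DecidableEq I] [Fintype B]

theorem mixExp_oneShot (G : StochasticGame I S B Y) (δ : ℝ) (i : I) (s : S) (w : S → Y → ℝ)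
    (α : I → MixedAction B) :
    mixExp α (G.oneShot δ i s w) =
      (1 - δ) * G.uMix i s α + δ * ∑ ty : S × Y, w ty.1 ty.2 * G.pMix s α ty := by
  have oneShot_eq : G.oneShot δ i s w =
      (1 - δ) • G.u i s + δ • ∑ ty : S × Y, w ty.1 ty.2 • fun a => G.p s a ty := by
    funext a
    simp [oneShot, mul_comm (w _ _)]
  rw [oneShot_eq, map_add, map_smul, map_smul, map_sum]
  simp only [map_smul, smul_eq_mul]
  rfl

theorem sum_pMix (G : StochasticGame I S B Y) (s : S) (α : I → MixedAction B) :
    ∑ ty, G.pMix s α ty = 1 := by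
  calc ∑ ty, G.pMix s α ty = mixExp α (∑ ty, fun a => G.p s a ty) := (map_sum (mixExp α) _ _).symm
    _ = mixExp α fun _ => 1 := by congr 1; funext a; simp [G.p_sum]
    _ = 1 := mixExp_const α 1

theorem mixExp_oneShot_add_const (G : StochasticGame I S B Y) (δ : ℝ) (i : I) (s : S)
    (w : S → Y → ℝ) (c : ℝ) (α : I → MixedAction B) :
    mixExp α (G.oneShot δ i s fun t y => w t y + c) = mixExp α (G.oneShot δ i s w) + δ * c := by
  simp only [mixExp_oneShot, add_mul, Finset.sum_add_distrib, ← Finset.mul_sum, G.sum_pMix]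
  ring

theorem mixExp_oneShot_of_transfer (G : StochasticGame I S B Y) {δ v z : ℝ} (i : I) (s : S)
    {w x : S → Y → ℝ} (hwx : ∀ t y, δ * w t y = z - (1 - δ) * v + (1 - δ) * x t y)
    (α : I → MixedAction B) :
    mixExp α (G.oneShot δ i s w) =
      z + (1 - δ) * (G.uMix i s α + ∑ ty : S × Y, x ty.1 ty.2 * G.pMix s α ty - v) := by
  have continuation : δ * ∑ ty : S × Y, w ty.1 ty.2 * G.pMix s α ty =
      z - (1 - δ) * v + (1 - δ) * ∑ ty : S × Y, x ty.1 ty.2 * G.pMix s α ty := by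
    simp only [Finset.mul_sum, ← mul_assoc, hwx, add_mul, Finset.sum_add_distrib]
    rw [← Finset.mul_sum, G.sum_pMix, mul_one]
  rw [mixExp_oneShot, continuation]
  ring

end OneShot

section Payoffs

variable {I S B Y : Type*} [Fintype I] [DecidableEq I] [Fintype S] [Fintype B] [Fintype Y]

theorem abs_u_le (G : StochasticGame I S B Y) (i : I) (s : S) (a : I → B) : |G.u i s a| ≤ ‖G.u‖ :=
  (norm_le_pi_norm (G.u i s) a).trans
    ((norm_le_pi_norm (G.u i) s).trans (norm_le_pi_norm G.u i))

theorem expStage_succ (G : StochasticGame I S B Y) (i : I) (k : ℕ) (s : S)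
    (σ : I → Strategy S B Y) :
    G.expStage i (k + 1) s σ = mixExp (fun j => σ j []) fun a =>
      ∑ ty, G.p s a ty * G.expStage i k ty.1 (nextProfile σ a ty) := rfl

theorem abs_expStage_le (G : StochasticGame I S B Y) (i : I) (k : ℕ) (s : S)
    (σ : I → Strategy S B Y) : |G.expStage i k s σ| ≤ ‖G.u‖ := by
  induction k generalizing s σ with
  | zero => exact abs_mixExp_le _ fun a => G.abs_u_le i s a
  | succ k ih =>
    rw [expStage_succ]
    refine abs_mixExp_le _ fun a => ?_
    calc |∑ ty, G.p s a ty * G.expStage i k ty.1 (nextProfile σ a ty)|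
        ≤ ∑ ty, |G.p s a ty * G.expStage i k ty.1 (nextProfile σ a ty)| :=
          Finset.abs_sum_le_sum_abs _ _
      _ ≤ ∑ ty, G.p s a ty * ‖G.u‖ := Finset.sum_le_sum fun ty _ => by
          rw [abs_mul, abs_of_nonneg (G.p_nonneg s a ty)]
          exact mul_le_mul_of_nonneg_left (ih _ _) (G.p_nonneg s a ty)
      _ = ‖G.u‖ := by rw [← Finset.sum_mul, G.p_sum, one_mul]

theorem abs_discounted_expStage_le (G : StochasticGame I S B Y) {δ : ℝ} (h0 : 0 ≤ δ) (i : I)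
    (k : ℕ) (s : S) (σ : I → Strategy S B Y) :
    |δ ^ k * G.expStage i k s σ| ≤ δ ^ k * ‖G.u‖ := by
  rw [abs_mul, abs_of_nonneg (pow_nonneg h0 k)]
  exact mul_le_mul_of_nonneg_left (G.abs_expStage_le i k s σ) (pow_nonneg h0 k)

theorem summable_discounted_expStage (G : StochasticGame I S B Y) {δ : ℝ} (h0 : 0 ≤ δ)
    (h1 : δ < 1) (i : I) (s : S) (σ : I → Strategy S B Y) :
    Summable fun k => δ ^ k * G.expStage i k s σ :=
  .of_norm_bounded ((summable_geometric_of_lt_one h0 h1).mul_right ‖G.u‖)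
    fun k => G.abs_discounted_expStage_le h0 i k s σ

theorem abs_payoff_le (G : StochasticGame I S B Y) {δ : ℝ} (h0 : 0 ≤ δ) (h1 : δ < 1)
    (i : I) (s : S) (σ : I → Strategy S B Y) : |G.payoff δ i s σ| ≤ ‖G.u‖ := by
  have h1' : 0 < 1 - δ := sub_pos.2 h1
  have hsum : |∑' k, δ ^ k * G.expStage i k s σ| ≤ (1 - δ)⁻¹ * ‖G.u‖ := by
    rw [← Real.norm_eq_abs]
    exact tsum_of_norm_bounded ((hasSum_geometric_of_lt_one h0 h1).mul_right ‖G.u‖)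
      fun k => G.abs_discounted_expStage_le h0 i k s σ
  calc |G.payoff δ i s σ| = (1 - δ) * |∑' k, δ ^ k * G.expStage i k s σ| := by
        rw [payoff, abs_mul, abs_of_pos h1']
    _ ≤ (1 - δ) * ((1 - δ)⁻¹ * ‖G.u‖) := by gcongr
    _ = ‖G.u‖ := mul_inv_cancel_left₀ h1'.ne' _

theorem tsum_discounted_expStage_succ (G : StochasticGame I S B Y) {δ : ℝ} (h0 : 0 ≤ δ)
    (h1 : δ < 1) (i : I) (s : S) (σ : I → Strategy S B Y) :
    ∑' k, δ ^ (k + 1) * G.expStage i (k + 1) s σ = δ * mixExp (fun j => σ j []) fun a =>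
      ∑ ty, G.p s a ty * ∑' k, δ ^ k * G.expStage i k ty.1 (nextProfile σ a ty) := by
  have hasSum_next : HasSum
      (fun k => mixExp (fun j => σ j []) fun a =>
        ∑ ty, G.p s a ty * (δ ^ k * G.expStage i k ty.1 (nextProfile σ a ty)))
      (mixExp (fun j => σ j []) fun a =>
        ∑ ty, G.p s a ty * ∑' k, δ ^ k * G.expStage i k ty.1 (nextProfile σ a ty)) :=
    hasSum_mixExp _ fun a => hasSum_sum fun ty _ =>
      (G.summable_discounted_expStage h0 h1 i ty.1 (nextProfile σ a ty)).hasSum.mul_left _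
  rw [← (hasSum_next.mul_left δ).tsum_eq]
  congr 1
  funext k
  rw [expStage_succ, pow_succ', mul_assoc, ← smul_eq_mul (δ ^ k), ← map_smul]
  congr 2
  funext a
  simp only [Pi.smul_apply, smul_eq_mul, Finset.mul_sum, mul_left_comm]

theorem payoff_eq_mixExp_oneShot (G : StochasticGame I S B Y) {δ : ℝ} (h0 : 0 ≤ δ) (h1 : δ < 1)
    (i : I) (s : S) (σ : I → Strategy S B Y) :
    G.payoff δ i s σ = mixExp (fun j => σ j []) fun a =>
      G.oneShot δ i s (fun t y => G.payoff δ i t (nextProfile σ a (t, y))) a := by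
  rw [payoff, (G.summable_discounted_expStage h0 h1 i s σ).tsum_eq_zero_add,
    G.tsum_discounted_expStage_succ h0 h1, pow_zero, one_mul,
    show G.expStage i 0 s σ = mixExp (fun j => σ j []) (G.u i s) from rfl, mul_add, mul_left_comm]
  simp only [← smul_eq_mul, ← map_smul, ← map_add]
  congr 1
  funext a
  simp only [oneShot, payoff, Pi.add_apply, Pi.smul_apply, smul_eq_mul, Finset.mul_sum,
    mul_left_comm]

theorem payoff_profileAfter (G : StochasticGame I S B Y) {δ : ℝ} (h0 : 0 ≤ δ) (h1 : δ < 1)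
    (i : I) (s : S) (σ : I → PublicStrategy S B Y) (h : List (Y × S)) :
    G.payoff δ i s (profileAfter σ h) = mixExp (fun j => σ j h)
      (G.oneShot δ i s fun t y => G.payoff δ i t (profileAfter σ (h ++ [(y, t)]))) := by
  rw [G.payoff_eq_mixExp_oneShot h0 h1]
  simp only [nextProfile_profileAfter, profileAfter_apply_nil]

theorem payoff_update (G : StochasticGame I S B Y) {δ : ℝ} (h0 : 0 ≤ δ) (h1 : δ < 1) (i j : I)
    (s : S) (σ : I → Strategy S B Y) (τ : Strategy S B Y) :
    G.payoff δ i s (update σ j τ) = mixExp (update (fun k => σ k []) j (τ [])) fun a =>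
      G.oneShot δ i s (fun t y => G.payoff δ i t
        (update (nextProfile σ a (t, y)) j fun l => τ ((a j, y, t) :: l))) a := by
  rw [G.payoff_eq_mixExp_oneShot h0 h1]
  simp only [nextProfile_update, apply_update (fun _ (τ : Strategy S B Y) => τ [])]

end Payoffs

section OneShotDeviation

variable {I S B Y : Type*} [Fintype I] [DecidableEq I] [Fintype S] [Fintype B] [Fintype Y]

theorem le_payoff_profileAfter (G : StochasticGame I S B Y) {δ : ℝ} (h0 : 0 ≤ δ) (h1 : δ < 1)
    (i : I) (s₀ : S) (σ : I → PublicStrategy S B Y) {w : List (Y × S) → ℝ} {D : ℝ}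
    (hw : ∀ h, w h ≤ D)
    (hval : ∀ h, w h ≤ mixExp (fun j => σ j h)
      (G.oneShot δ i (currentState s₀ h) fun t y => w (h ++ [(y, t)])))
    (h : List (Y × S)) : w h ≤ G.payoff δ i (currentState s₀ h) (profileAfter σ h) := by
  refine sub_nonpos.1 (nonpos_of_forall_le_imp_le_mul
    (g := fun h => w h - G.payoff δ i (currentState s₀ h) (profileAfter σ h)) h1
    ⟨D + ‖G.u‖, Set.forall_mem_range.2 fun h => ?_⟩ (fun M hM h => ?_) h)
  · have := (abs_le.1 (G.abs_payoff_le h0 h1 i (currentState s₀ h) (profileAfter σ h))).1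
    linarith [hw h]
  · have next (t : S) (y : Y) :
        w (h ++ [(y, t)]) ≤ G.payoff δ i t (profileAfter σ (h ++ [(y, t)])) + M := by
      have := hM (h ++ [(y, t)])
      rw [currentState_append_singleton] at this
      linarith
    rw [G.payoff_profileAfter h0 h1, sub_le_iff_le_add', ← G.mixExp_oneShot_add_const]
    exact (hval h).trans (mixExp_mono _ fun a => G.oneShot_mono h0 i _ a next)

theorem IsNash.mixExp_update_le {G : StochasticGame I S B Y} {δ : ℝ} {s : S}
    {σ : I → PublicStrategy S B Y} {h : List (Y × S)} (hσ : G.IsNash δ s (profileAfter σ h))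
    (h0 : 0 ≤ δ) (h1 : δ < 1) (i : I) (β : MixedAction B) :
    mixExp (update (fun j => σ j h) i β)
      (G.oneShot δ i s fun t y => G.payoff δ i t (profileAfter σ (h ++ [(y, t)]))) ≤
      G.payoff δ i s (profileAfter σ h) := by
  classical
  have deviation := hσ i (update (profileAfter σ h i) [] β)
  have next (a : I → B) (t : S) (y : Y) :
      update (nextProfile (profileAfter σ h) a (t, y)) i
        (fun l => update (profileAfter σ h i) [] β ((a i, y, t) :: l)) =
        profileAfter σ (h ++ [(y, t)]) := by
    rw [nextProfile_profileAfter, update_eq_self_iff, ← nextProfile_profileAfter σ h a (t, y)]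
    exact funext fun l => update_of_ne (List.cons_ne_nil _ _) _ _
  rw [G.payoff_update h0 h1] at deviation
  simpa only [next, profileAfter_apply_nil, update_self] using deviation

theorem IsPPE.after {G : StochasticGame I S B Y} {δ : ℝ} {s : S} {σ : I → PublicStrategy S B Y}
    (hσ : G.IsPPE δ s σ) (h : List (Y × S)) :
    G.IsPPE δ (currentState s h) fun i => (σ i).after h := fun h' => by
  have hσ' : G.IsNash δ (currentState s (h ++ h')) (profileAfter σ (h ++ h')) := hσ (h ++ h')
  rwa [currentState_append, ← profileAfter_after] at hσ'

variable [DecidableEq B]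

theorem payoff_update_profileAfter_le (G : StochasticGame I S B Y) {δ : ℝ} (h0 : 0 ≤ δ)
    (h1 : δ < 1) (i : I) (s₀ : S) (σ : I → PublicStrategy S B Y) {w : List (Y × S) → ℝ} {D : ℝ}
    (hw : ∀ h, D ≤ w h)
    (hinc : ∀ h b, mixExp (update (fun j => σ j h) i (pureAction b))
      (G.oneShot δ i (currentState s₀ h) fun t y => w (h ++ [(y, t)])) ≤ w h)
    (h : List (Y × S)) (τ : Strategy S B Y) :
    G.payoff δ i (currentState s₀ h) (update (profileAfter σ h) i τ) ≤ w h := by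
  refine sub_nonpos.1 (nonpos_of_forall_le_imp_le_mul
    (g := fun q : List (Y × S) × Strategy S B Y =>
      G.payoff δ i (currentState s₀ q.1) (update (profileAfter σ q.1) i q.2) - w q.1) h1
    ⟨‖G.u‖ - D, Set.forall_mem_range.2 fun ⟨h, τ⟩ => ?_⟩ (fun M hM ⟨h, τ⟩ => ?_) (h, τ))
  · have := (abs_le.1 (G.abs_payoff_le h0 h1 i (currentState s₀ h)
      (update (profileAfter σ h) i τ))).2
    linarith [hw h]
  · have next (a : I → B) (t : S) (y : Y) :
        G.payoff δ i t (update (nextProfile (profileAfter σ h) a (t, y)) i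
          fun l => τ ((a i, y, t) :: l)) ≤ w (h ++ [(y, t)]) + M := by
      have := hM (h ++ [(y, t)], fun l => τ ((a i, y, t) :: l))
      rw [currentState_append_singleton] at this
      rw [nextProfile_profileAfter]
      linarith
    rw [sub_le_iff_le_add', G.payoff_update h0 h1]
    simp only [profileAfter_apply_nil]
    calc _ ≤ mixExp (update (fun j => σ j h) i (τ []))
          (G.oneShot δ i (currentState s₀ h) fun t y => w (h ++ [(y, t)]) + M) :=
          mixExp_mono _ fun a => G.oneShot_mono h0 i _ a (next a)
      _ = mixExp (update (fun j => σ j h) i (τ []))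
          (G.oneShot δ i (currentState s₀ h) fun t y => w (h ++ [(y, t)])) + δ * M :=
          G.mixExp_oneShot_add_const δ i _ _ M _
      _ ≤ w h + δ * M := by gcongr; exact mixExp_update_le _ i (τ []) (hinc h)

theorem isPPE_of_oneShot (G : StochasticGame I S B Y) {δ : ℝ} (h0 : 0 ≤ δ) (h1 : δ < 1) (s₀ : S)
    (σ : I → PublicStrategy S B Y) {w : I → List (Y × S) → ℝ} {D : ℝ} (hw : ∀ i h, |w i h| ≤ D)
    (hval : ∀ i h, mixExp (fun j => σ j h)
      (G.oneShot δ i (currentState s₀ h) fun t y => w i (h ++ [(y, t)])) = w i h)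
    (hinc : ∀ i h b, mixExp (update (fun j => σ j h) i (pureAction b))
      (G.oneShot δ i (currentState s₀ h) fun t y => w i (h ++ [(y, t)])) ≤ w i h) :
    G.IsPPE δ s₀ σ ∧ ∀ i, G.payoff δ i s₀ (profileAfter σ []) = w i [] := by
  have upper (i : I) := G.payoff_update_profileAfter_le h0 h1 i s₀ σ
    (fun h => (abs_le.1 (hw i h)).1) (hinc i)
  have lower (i : I) := G.le_payoff_profileAfter h0 h1 i s₀ σ
    (fun h => (abs_le.1 (hw i h)).2) (fun h => (hval i h).ge)
  refine ⟨fun h i τ => (upper i h τ).trans (lower i h), fun i => le_antisymm ?_ (lower i [])⟩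
  rw [← update_eq_self i (profileAfter σ [])]
  exact upper i [] _

end OneShotDeviation

section Symmetry

variable {I S B Y : Type*} [Fintype I] [DecidableEq I] [Fintype S] [Fintype B] [Fintype Y]

theorem expStage_comp_perm {G : StochasticGame I S B Y} (hG : G.IsSymmetric) (τ : Equiv.Perm I)
    (i : I) (k : ℕ) (s : S) (σ : I → Strategy S B Y) :
    G.expStage (τ i) k s (σ ∘ τ.symm) = G.expStage i k s σ := by
  induction k generalizing s σ with
  | zero =>
    calc G.expStage (τ i) 0 s (σ ∘ τ.symm)
        = mixExp (fun j => σ j []) fun a => G.u (τ i) s (a ∘ τ.symm) :=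
          mixExp_comp_perm (fun j => σ j []) τ _
      _ = mixExp (fun j => σ j []) (G.u i s) := by simp only [(hG τ s _).1]
  | succ k ih =>
    have next (a : I → B) (ty : S × Y) :
        nextProfile (σ ∘ τ.symm) (a ∘ τ.symm) ty = nextProfile σ a ty ∘ τ.symm := rfl
    rw [expStage_succ, expStage_succ]
    refine (mixExp_comp_perm (fun j => σ j []) τ _).trans ?_
    simp only [(hG τ s _).2, next, ih]

theorem payoff_comp_perm {G : StochasticGame I S B Y} (hG : G.IsSymmetric) (δ : ℝ)
    (τ : Equiv.Perm I) (i : I) (s : S) (σ : I → Strategy S B Y) :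
    G.payoff δ (τ i) s (σ ∘ τ.symm) = G.payoff δ i s σ := by
  simp only [payoff, expStage_comp_perm hG]

theorem payoff_const_eq {G : StochasticGame I S B Y} (hG : G.IsSymmetric) (δ : ℝ) (i j : I) (s : S)
    (ρ : Strategy S B Y) : G.payoff δ i s (fun _ => ρ) = G.payoff δ j s fun _ => ρ := by
  have := payoff_comp_perm hG δ (Equiv.swap i j) i s fun _ => ρ
  rwa [Equiv.swap_apply_left, eq_comm] at this

end Symmetry

end StochasticGame

section Potentials

variable {S Y M : Type*}

/-- The total weight of the steps between consecutive points of the walk `l`, when a step from `s`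
to `t` has weight `m s t`. -/
def walkWeight [AddCommMonoid M] (m : S → S → M) (l : List S) : M :=
  (List.zipWith m l l.tail).sum

theorem walkWeight_cons_cons [AddCommMonoid M] (m : S → S → M) (s t : S) (l : List S) :
    walkWeight m (s :: t :: l) = m s t + walkWeight m (t :: l) := by
  simp [walkWeight]

theorem walkWeight_append [AddCommMonoid M] (m : S → S → M) (l₁ : List S) (s : S) (l₂ : List S) :
    walkWeight m (l₁ ++ s :: l₂) = walkWeight m (l₁ ++ [s]) + walkWeight m (s :: l₂) := by
  induction l₁ with
  | nil => simp [walkWeight]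
  | cons a l ih =>
    cases l with
    | nil => simp [walkWeight]
    | cons b l => simp only [List.cons_append, walkWeight_cons_cons, add_assoc] at ih ⊢; rw [ih]

theorem walkWeight_closed [DecidableEq S] [AddCommMonoid M] (m : S → S → M) {s : S} {l : List S}
    (hl : (s :: l).Nodup) :
    walkWeight m (s :: (l ++ [s])) = ∑ t ∈ (s :: l).toFinset, m t ((s :: l).formPerm t) := by
  have map_formPerm : (s :: l).map (s :: l).formPerm = l ++ [s] := by
    rw [show l ++ [s] = (s :: l).rotate 1 by simp]
    refine List.ext_getElem (by simp) fun n h₁ h₂ => ?_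
    rw [List.getElem_map, List.formPerm_apply_getElem _ hl, List.getElem_rotate]
  have steps : List.zipWith m (s :: (l ++ [s])) (l ++ [s]) =
      (s :: l).map fun t => m t ((s :: l).formPerm t) := by
    calc List.zipWith m (s :: (l ++ [s])) (l ++ [s])
        = List.zipWith m ((s :: l) ++ [s]) ((s :: l).map (s :: l).formPerm ++ []) := by
          rw [map_formPerm, List.append_nil, List.cons_append]
      _ = List.zipWith m (s :: l) ((s :: l).map (s :: l).formPerm) := by
          rw [List.zipWith_append (by simp), List.zipWith_nil_right, List.append_nil]
      _ = (s :: l).map fun t => m t ((s :: l).formPerm t) := by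
          rw [List.zipWith_map_right, List.zipWith_self]
  rw [List.sum_toFinset _ hl, ← steps, walkWeight, List.tail_cons]

theorem walkWeight_closed_nonpos [AddCommMonoid M] [PartialOrder M] {m : S → S → M}
    (hm : ∀ (T : Finset S) (ξ : Equiv.Perm T), ∑ s : T, m s (ξ s) ≤ 0) {s : S} {l : List S}
    (hl : (s :: l).Nodup) : walkWeight m (s :: (l ++ [s])) ≤ 0 := by
  classical
  let ξ : Equiv.Perm (s :: l).toFinset := (s :: l).formPerm.subtypePerm fun t => by
    simp only [List.mem_toFinset, List.formPerm_mem_iff_mem]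
  rw [walkWeight_closed m hl, ← Finset.sum_coe_sort]
  exact hm _ ξ

theorem exists_nodup_cons_forall_walkWeight_le [Finite S] [AddCommMonoid M] [LinearOrder M]
    (m : S → S → M) (s : S) : ∃ l, (s :: l).Nodup ∧
      ∀ l', (s :: l').Nodup → walkWeight m (s :: l') ≤ walkWeight m (s :: l) := by
  classical
  have := Fintype.ofFinite S
  have paths_finite : {l : List S | (s :: l).Nodup}.Finite :=
    (Set.finite_coe_iff.1 (inferInstanceAs (Finite {l : List S // l.Nodup}))).subset
      fun l hl => (List.nodup_cons.1 hl).2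
  exact Set.exists_max_image _ (fun l => walkWeight m (s :: l)) paths_finite
    ⟨[], List.nodup_singleton s⟩

/-- The potential of `s` is the maximal weight of a simple path that starts at `s`. -/
theorem exists_potential [Finite S] [AddCommMonoid M] [LinearOrder M] [IsOrderedAddMonoid M]
    {m : S → S → M} (hm : ∀ (T : Finset S) (ξ : Equiv.Perm T), ∑ s : T, m s (ξ s) ≤ 0) :
    ∃ θ : S → M, ∀ s t, m s t + θ t ≤ θ s := by
  choose P hP hPmax using exists_nodup_cons_forall_walkWeight_le m
  refine ⟨fun s => walkWeight m (s :: P s), fun s t => ?_⟩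
  rw [← walkWeight_cons_cons]
  by_cases hs : s ∈ t :: P t
  · obtain ⟨l₁, l₂, path_eq⟩ := List.append_of_mem hs
    have nodup : (s :: (l₁ ++ l₂)).Nodup := List.nodup_middle.1 (path_eq ▸ hP t)
    have loop : walkWeight m (s :: (l₁ ++ [s])) ≤ 0 :=
      walkWeight_closed_nonpos hm (nodup.sublist (by simp))
    calc walkWeight m (s :: t :: P t)
        = walkWeight m (s :: (l₁ ++ [s])) + walkWeight m (s :: l₂) := by
          rw [path_eq, ← List.cons_append, walkWeight_append, List.cons_append]
      _ ≤ walkWeight m (s :: l₂) := add_le_of_nonpos_left loop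
      _ ≤ walkWeight m (s :: P s) := hPmax s l₂ (nodup.sublist (by simp))
  · exact hPmax s (t :: P t) (List.nodup_cons.2 ⟨hs, hP t⟩)

theorem exists_potential_iff [Finite S] [Finite Y] [AddCommGroup M] [LinearOrder M]
    [IsOrderedAddMonoid M] {x : S → S → Y → M} :
    (∃ θ : S → M, ∀ s t y, x s t y + θ t ≤ θ s) ↔
      ∀ (T : Finset S) (ξ : Equiv.Perm T) (ψ : T → Y), ∑ s : T, x s (ξ s) (ψ s) ≤ 0 := by
  constructor
  · rintro ⟨θ, hθ⟩ T ξ ψ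
    calc ∑ s : T, x s (ξ s) (ψ s) ≤ ∑ s : T, (θ s - θ (ξ s)) :=
          Finset.sum_le_sum fun s _ => le_sub_iff_add_le.2 (hθ s (ξ s) (ψ s))
      _ = 0 := by
          rw [Finset.sum_sub_distrib, Equiv.sum_comp ξ fun s : T => θ s, sub_self]
  · intro hx
    rcases isEmpty_or_nonempty Y with hY | hY
    · exact ⟨0, fun _ _ => hY.elim⟩
    · choose Ψ hΨ using fun s t => Finite.exists_max (x s t)
      obtain ⟨θ, hθ⟩ := exists_potential (m := fun s t => x s t (Ψ s t))
        fun T ξ => hx T ξ fun s => Ψ s (ξ s)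
      exact ⟨θ, fun s t y => (add_le_add_left (hΨ s t y) (θ t)).trans (hθ s t)⟩

end Potentials

section Bands

variable {S : Type*}

/-- The payoffs between the bounds `b`, up to the slack `c * K` and shifted by `c` times the
potentials `θ`, at the state `s`. A direction is a unit `ε = ±1` of `ℤ`, and `b ε` bounds the payoff
in that direction. -/
def driftBand (θ : ℤˣ → S → ℝ) (b : ℤˣ → ℝ) (c K : ℝ) (s : S) : Set ℝ :=
  {w | ∀ ε : ℤˣ, ((ε : ℤ) : ℝ) * w + c * θ ε s ≤ b ε + c * K}

theorem driftBand_step {θ : ℤˣ → S → ℝ} {b : ℤˣ → ℝ} {c K : ℝ} (hc : 0 ≤ c) {s t : S} {w : ℝ}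
    (hw : w ∈ driftBand θ b c K s) {ε : ℤˣ} (hε : -b (-ε) ≤ ((ε : ℤ) : ℝ) * w) {v ξ : ℝ}
    (hv : b ε + c * (K - θ ε s) ≤ ((ε : ℤ) : ℝ) * v)
    (hθ : ((ε : ℤ) : ℝ) * ξ + θ ε t ≤ θ ε s)
    (hK : ((ε : ℤ) : ℝ) * v + b (-ε) - ((ε : ℤ) : ℝ) * ξ + θ (-ε) t ≤ K) :
    w - c * (v - w) + c * ξ ∈ driftBand θ b c K t := by
  intro ε'
  rcases eq_or_ne ε' ε with rfl | hne
  · have drift : 0 ≤ c * (((ε' : ℤ) : ℝ) * v - ((ε' : ℤ) : ℝ) * w) :=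
      mul_nonneg hc (by linarith [hw ε'])
    linear_combination hw ε' + drift + c * hθ
  · obtain rfl : ε' = -ε := Int.units_ne_iff_eq_neg.1 hne
    have overshoot : c * (((ε : ℤ) : ℝ) * v - ((ε : ℤ) : ℝ) * w - ((ε : ℤ) : ℝ) * ξ + θ (-ε) t) ≤
        c * K := mul_le_mul_of_nonneg_left (by linarith) hc
    push_cast
    linear_combination overshoot + hε

theorem abs_le_of_mem_driftBand {θ : ℤˣ → S → ℝ} {b v : ℤˣ → ℝ} {c K : ℝ} {s : S}
    (hv : ∀ ε : ℤˣ, b ε + c * (K - θ ε s) ≤ ((ε : ℤ) : ℝ) * v ε) {w : ℝ}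
    (hw : w ∈ driftBand θ b c K s) : |w| ≤ max (v 1) (-v (-1)) := by
  have bound (ε : ℤˣ) : ((ε : ℤ) : ℝ) * w ≤ ((ε : ℤ) : ℝ) * v ε := by linarith [hw ε, hv ε]
  have upper : w ≤ v 1 := by simpa using bound 1
  have lower : v (-1) ≤ w := by simpa using bound (-1)
  exact abs_le.2 ⟨by linarith [le_max_right (v 1) (-v (-1))], upper.trans (le_max_left _ _)⟩

end Bands

namespace StochasticGame

variable {I S B Y : Type*} [Fintype I] [DecidableEq I] [Fintype S] [Fintype B] [Fintype Y]

/-- The set of payoffs of strongly symmetric equilibria with initial state `s` in which only mixed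
actions in `A` are used. Both equilibrium notions of the theorem are instances: all mixed actions
are allowed in `sseSet`, the degenerate ones in `pureSseSet`. -/
def sseSetIn (G : StochasticGame I S B Y) (A : Set (MixedAction B)) (δ : ℝ) (s : S) : Set ℝ :=
  {v | ∃ σ : I → PublicStrategy S B Y, G.IsSSE δ s σ ∧ (∀ i h, σ i h ∈ A) ∧
    ∀ i, G.payoff δ i s (fun j => (σ j).toStrategy) = v}

theorem sseSetIn_univ (G : StochasticGame I S B Y) (δ : ℝ) (s : S) :
    G.sseSetIn Set.univ δ s = G.sseSet δ s := by
  simp [sseSetIn, sseSet]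

variable [DecidableEq B]

/-- The score in direction `l` when only mixed actions in `A` are used; it specializes to `kSS` and
`kSSPure`. -/
def scoreIn (G : StochasticGame I S B Y) (A : Set (MixedAction B)) (l : ℝ) : EReal :=
  sSup {r | ∃ α v x, (∀ s, α s ∈ A) ∧ G.Feasible l α v x ∧ r = ((l * v : ℝ) : EReal)}

theorem scoreIn_univ (G : StochasticGame I S B Y) (l : ℝ) : G.scoreIn Set.univ l = G.kSS l := by
  simp [scoreIn, kSS]

theorem sseSetIn_pure (G : StochasticGame I S B Y) (δ : ℝ) (s : S) :
    G.sseSetIn {β | ∃ b, β = pureAction b} δ s = G.pureSseSet δ s := rfl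

theorem scoreIn_pure (G : StochasticGame I S B Y) (l : ℝ) :
    G.scoreIn {β | ∃ b, β = pureAction b} l = G.kSSPure l := by
  refine congrArg sSup (Set.ext fun r => ⟨?_, ?_⟩)
  · rintro ⟨α, v, x, hα, hf, rfl⟩
    choose a ha using hα
    obtain rfl : α = fun s => pureAction (a s) := funext ha
    exact ⟨a, v, x, hf, rfl⟩
  · rintro ⟨a, v, x, hf, rfl⟩
    exact ⟨_, v, x, fun s => ⟨a s, rfl⟩, hf, rfl⟩

section SelfGeneration

/-- The continuation payoffs `w`, common to all players, enforce the mixed action `α` with payoff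
`v` at state `s`: everyone playing `α` is a Nash equilibrium with payoff `v` of the one-shot game
with these continuation payoffs. -/
structure Enforces (G : StochasticGame I S B Y) (δ : ℝ) (s : S) (α : MixedAction B)
    (w : S → Y → ℝ) (v : ℝ) : Prop where
  value : ∀ i, mixExp (fun _ => α) (G.oneShot δ i s w) = v
  incentive : ∀ i b, mixExp (update (fun _ => α) i (pureAction b)) (G.oneShot δ i s w) ≤ v

/-- Self-generation in the sense of Abreu, Pearce and Stacchetti, for state-dependent payoff sets
and actions in `A`: each payoff in `E s` is enforced at `s` by continuation payoffs from `E`. -/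
def SelfGenerating (G : StochasticGame I S B Y) (A : Set (MixedAction B)) (δ : ℝ)
    (E : S → Set ℝ) : Prop :=
  ∀ s, ∀ v ∈ E s, ∃ α ∈ A, ∃ w : S → Y → ℝ, G.Enforces δ s α w v ∧ ∀ t y, w t y ∈ E t

theorem selfGenerating_sseSetIn [Nonempty I] {G : StochasticGame I S B Y} (hG : G.IsSymmetric)
    (A : Set (MixedAction B)) {δ : ℝ} (h0 : 0 ≤ δ) (h1 : δ < 1) :
    G.SelfGenerating A δ (G.sseSetIn A δ) := by
  rintro s v ⟨σ, ⟨ppe, common⟩, hA, hv⟩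
  let i₀ : I := Classical.arbitrary I
  obtain ⟨ρ, rfl⟩ : ∃ ρ, σ = fun _ => ρ := ⟨σ i₀, funext fun i => funext fun h => common i i₀ h⟩
  let w (t : S) (y : Y) : ℝ := G.payoff δ i₀ t (profileAfter (fun _ => ρ) [(y, t)])
  have hw (i : I) (t : S) (y : Y) :
      G.payoff δ i t (profileAfter (fun _ => ρ) [(y, t)]) = w t y :=
    payoff_const_eq hG δ i i₀ t _
  rw [← profileAfter_nil] at hv
  refine ⟨ρ [], hA i₀ [], w, ⟨fun i => ?_, fun i b => ?_⟩, fun t y =>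
    ⟨_, ⟨ppe.after [(y, t)], fun _ _ _ => rfl⟩, fun i h => hA i _, fun i => hw i t y⟩⟩
  · simpa only [hw, hv, List.nil_append, eq_comm] using
      G.payoff_profileAfter h0 h1 i s (fun _ => ρ) []
  · have nash : G.IsNash δ s (profileAfter (fun _ => ρ) []) := ppe []
    simpa only [hw, hv, List.nil_append] using nash.mixExp_update_le h0 h1 i (pureAction b)

theorem SelfGenerating.subset_sseSetIn {G : StochasticGame I S B Y} {A : Set (MixedAction B)}
    {δ : ℝ} {E : S → Set ℝ} (hE : G.SelfGenerating A δ E) (h0 : 0 ≤ δ) (h1 : δ < 1) {D : ℝ}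
    (hD : ∀ s, ∀ v ∈ E s, |v| ≤ D) (s₀ : S) : E s₀ ⊆ G.sseSetIn A δ s₀ := by
  intro v hv
  choose α hα w enforces hw using fun q : (s : S) × E s => hE q.1 q.2 q.2.2
  let next (q : (s : S) × E s) (o : Y × S) : (s : S) × E s := ⟨o.2, w q o.2 o.1, hw q o.2 o.1⟩
  let promise (h : List (Y × S)) : (s : S) × E s := h.foldl next ⟨s₀, v, hv⟩
  have promise_state (h : List (Y × S)) : (promise h).1 = currentState s₀ h :=
    foldl_eq_currentState (f := Sigma.fst) (fun _ _ => rfl) _ h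
  have promise_next (h : List (Y × S)) (t : S) (y : Y) :
      ((promise (h ++ [(y, t)])).2 : ℝ) = w (promise h) t y :=
    congrArg (fun q : (s : S) × E s => (q.2 : ℝ)) (List.foldl_concat ..)
  obtain ⟨ppe, payoff_eq⟩ := G.isPPE_of_oneShot h0 h1 s₀ (fun _ : I => fun h => α (promise h))
    (w := fun _ h => (promise h).2) (fun _ h => hD _ _ (promise h).2.2)
    (fun i h => by simpa only [promise_next, promise_state] using (enforces (promise h)).value i)
    (fun i h b => by
      simpa only [promise_next, promise_state] using (enforces (promise h)).incentive i b)
  exact ⟨_, ⟨ppe, fun _ _ _ => rfl⟩, fun _ h => hα (promise h), payoff_eq⟩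

end SelfGeneration

section Transfers

theorem Feasible.enforces {G : StochasticGame I S B Y} {l v : ℝ} {α : S → MixedAction B}
    {x : S → S → Y → ℝ} (hf : G.Feasible l α v x) {δ z : ℝ} (h1 : δ ≤ 1) {s : S} {w : S → Y → ℝ}
    (hwx : ∀ t y, δ * w t y = z - (1 - δ) * v + (1 - δ) * x s t y) :
    G.Enforces δ s (α s) w z where
  value i := by
    rw [G.mixExp_oneShot_of_transfer i s hwx, ← hf.value s i, sub_self, mul_zero, add_zero]
  incentive i b := by
    rw [G.mixExp_oneShot_of_transfer i s hwx]
    have := mul_nonneg (sub_nonneg.2 h1) (sub_nonneg.2 (hf.incentive s i b))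
    linarith

theorem feasible_of_enforces {G : StochasticGame I S B Y} {δ l v : ℝ} (h1 : δ < 1)
    {α : S → MixedAction B} {z : S → ℝ} {w x : S → S → Y → ℝ} {θ : S → ℝ}
    (henf : ∀ s, G.Enforces δ s (α s) (w s) (z s))
    (hwx : ∀ s t y, δ * w s t y = z s - (1 - δ) * v + (1 - δ) * x s t y)
    (hθ : ∀ s t y, l * x s t y + θ t ≤ θ s) : G.Feasible l α v x where
  value s i := by
    have := (henf s).value i
    rw [G.mixExp_oneShot_of_transfer i s (hwx s), add_eq_left, mul_eq_zero,
      or_iff_right (sub_pos.2 h1).ne'] at this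
    exact (sub_eq_zero.1 this).symm
  incentive s i b := by
    have := (henf s).incentive i b
    rw [G.mixExp_oneShot_of_transfer i s (hwx s), add_le_iff_nonpos_right] at this
    exact sub_nonpos.1 (nonpos_of_mul_nonpos_right this (sub_pos.2 h1))
  cycle T ξ ψ := by
    rw [Finset.mul_sum]
    exact exists_potential_iff (x := fun s t y => l * x s t y).1 ⟨θ, hθ⟩ T ξ ψ

theorem Feasible.exists_potential {G : StochasticGame I S B Y} {l v : ℝ} {α : S → MixedAction B}
    {x : S → S → Y → ℝ} (hf : G.Feasible l α v x) :
    ∃ θ : S → ℝ, ∀ s t y, l * x s t y + θ t ≤ θ s :=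
  exists_potential_iff.2 fun T ξ ψ => by
    simpa only [Finset.mul_sum] using hf.cycle T ξ ψ

end Transfers

section UpperBound

theorem SelfGenerating.exists_feasible {G : StochasticGame I S B Y} {A : Set (MixedAction B)}
    {δ : ℝ} {E : S → Set ℝ} (hE : G.SelfGenerating A δ E) (h0 : 0 ≤ δ) (h1 : δ < 1) {l : ℝ}
    (hl : l * l = 1) (hbdd : ∀ s, BddAbove ((l * ·) '' E s)) {v : ℝ} (hv : ∀ s, v ∈ E s)
    {η : ℝ} (hη : 0 < η) : ∃ α x, (∀ s, α s ∈ A) ∧ G.Feasible l α (v - l * η) x := by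
  have h1' : 0 < 1 - δ := sub_pos.2 h1
  let W (s : S) : ℝ := sSup ((l * ·) '' E s)
  have le_W {s : S} {r : ℝ} (hr : r ∈ E s) : l * r ≤ W s := le_csSup (hbdd s) ⟨r, hr, rfl⟩
  have near_max (s : S) : ∃ z ∈ E s, W s - (1 - δ) * η < l * z := by
    obtain ⟨_, ⟨z, hz, rfl⟩, hlt⟩ := exists_lt_of_lt_csSup (Set.image_nonempty.2 ⟨v, hv s⟩)
      (sub_lt_self (W s) (mul_pos h1' hη))
    exact ⟨z, hz, hlt⟩
  choose z hz hzW using near_max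
  choose α hα w enforces hw using fun s => hE s (z s) (hz s)
  let κ := δ / (1 - δ)
  have hκ : κ * (1 - δ) = δ := div_mul_cancel₀ δ h1'.ne'
  have hκ0 : 0 ≤ κ := div_nonneg h0 h1'.le
  refine ⟨α, fun s t y => κ * (w s t y - z s) + (v - z s) - l * η, hα,
    feasible_of_enforces h1 (θ := fun s => -(κ * W s)) enforces (fun s t y => ?_) fun s t y => ?_⟩
  · linear_combination (-(w s t y) + z s) * hκ
  · have continuation : κ * (l * w s t y) ≤ κ * W t :=
      mul_le_mul_of_nonneg_left (le_W (hw s t y)) hκ0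
    have slack : (κ + 1) * (W s - l * z s) ≤ η :=
      calc (κ + 1) * (W s - l * z s) ≤ (κ + 1) * ((1 - δ) * η) := by
            gcongr; linarith [hzW s]
        _ = η := by linear_combination η * hκ
    linear_combination continuation + slack + le_W (hv s) - η * hl

theorem SelfGenerating.coe_mul_le_scoreIn {G : StochasticGame I S B Y} {A : Set (MixedAction B)}
    {δ : ℝ} {E : S → Set ℝ} (hE : G.SelfGenerating A δ E) (h0 : 0 ≤ δ) (h1 : δ < 1) {l : ℝ}
    (hl : l * l = 1) (hbdd : ∀ s, BddAbove ((l * ·) '' E s)) {v : ℝ} (hv : ∀ s, v ∈ E s) :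
    ((l * v : ℝ) : EReal) ≤ G.scoreIn A l := by
  refine EReal.ge_of_forall_gt_iff_ge.1 fun r hr => ?_
  have hη : 0 < l * v - r := sub_pos.2 (EReal.coe_lt_coe_iff.1 hr)
  obtain ⟨α, x, hα, hf⟩ := hE.exists_feasible h0 h1 hl hbdd hv hη
  refine le_sSup ⟨α, _, x, hα, hf, congrArg _ ?_⟩
  linear_combination (l * v - r) * hl

theorem coe_mul_le_scoreIn [Nonempty I] {G : StochasticGame I S B Y} (hG : G.IsSymmetric)
    {A : Set (MixedAction B)} {δ : ℝ} (h0 : 0 ≤ δ) (h1 : δ < 1) {l : ℝ} (hl : l * l = 1) {v : ℝ}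
    (hv : ∀ s, v ∈ G.sseSetIn A δ s) : ((l * v : ℝ) : EReal) ≤ G.scoreIn A l := by
  refine (selfGenerating_sseSetIn hG A h0 h1).coe_mul_le_scoreIn h0 h1 hl (fun s => ?_) hv
  refine ⟨|l| * ‖G.u‖, Set.forall_mem_image.2 ?_⟩
  rintro z ⟨σ, -, -, hz⟩
  rw [← hz (Classical.arbitrary I)]
  exact (le_abs_self _).trans (by rw [abs_mul]; gcongr; exact G.abs_payoff_le h0 h1 _ _ _)

end UpperBound

section LowerBound

theorem selfGenerating_driftBand {G : StochasticGame I S B Y} {A : Set (MixedAction B)}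
    {α : ℤˣ → S → MixedAction B} {v b : ℤˣ → ℝ} {x : ℤˣ → S → S → Y → ℝ} {θ : ℤˣ → S → ℝ}
    {δ K : ℝ} (h0 : 0 < δ) (h1 : δ ≤ 1) (hb : 0 ≤ b 1 + b (-1)) (hα : ∀ ε s, α ε s ∈ A)
    (hf : ∀ ε : ℤˣ, G.Feasible (ε : ℤ) (α ε) (v ε) (x ε))
    (hθ : ∀ (ε : ℤˣ) s t y, ((ε : ℤ) : ℝ) * x ε s t y + θ ε t ≤ θ ε s)
    (hv : ∀ (ε : ℤˣ) s, b ε + (1 - δ) / δ * (K - θ ε s) ≤ ((ε : ℤ) : ℝ) * v ε)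
    (hK : ∀ (ε : ℤˣ) s t y,
      ((ε : ℤ) : ℝ) * v ε + b (-ε) - ((ε : ℤ) : ℝ) * x ε s t y + θ (-ε) t ≤ K) :
    G.SelfGenerating A δ (driftBand θ b ((1 - δ) / δ) K) := by
  intro s w hw
  obtain ⟨ε, hε⟩ : ∃ ε : ℤˣ, -b (-ε) ≤ ((ε : ℤ) : ℝ) * w := by
    rcases le_total (-b (-1)) w with h | h
    · exact ⟨1, by simpa using h⟩
    · exact ⟨-1, by simp; linarith⟩
  refine ⟨α ε s, hα ε s, fun t y => w - (1 - δ) / δ * (v ε - w) + (1 - δ) / δ * x ε s t y,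
    (hf ε).enforces h1 fun t y => ?_, fun t y =>
    driftBand_step (div_nonneg (sub_nonneg.2 h1) h0.le) hw hε (hv ε s) (hθ ε s t y) (hK ε s t y)⟩
  field_simp
  ring


theorem eventually_subset_sseSetIn (G : StochasticGame I S B Y) (A : Set (MixedAction B))
    {b : ℤˣ → ℝ} (hb : ∀ ε : ℤˣ, (b ε : EReal) < G.scoreIn A (ε : ℤ)) :
    ∀ᶠ δ in 𝓝[<] 1, ∀ s, {w | ∀ ε : ℤˣ, ((ε : ℤ) : ℝ) * w ≤ b ε} ⊆ G.sseSetIn A δ s := by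
  have near_score (ε : ℤˣ) : ∃ α v x, (∀ s, α s ∈ A) ∧ G.Feasible (ε : ℤ) α v x ∧
      b ε < ((ε : ℤ) : ℝ) * v := by
    obtain ⟨_, ⟨α, v, x, hα, hf, rfl⟩, hlt⟩ := lt_sSup_iff.1 (hb ε)
    exact ⟨α, v, x, hα, hf, EReal.coe_lt_coe_iff.1 hlt⟩
  choose α v x hα hf hv using near_score
  choose θ hθ using fun ε => (hf ε).exists_potential
  obtain ⟨K, hK, hθK⟩ : ∃ K, (∀ (ε : ℤˣ) s t y,
      ((ε : ℤ) : ℝ) * v ε + b (-ε) - ((ε : ℤ) : ℝ) * x ε s t y + θ (-ε) t ≤ K) ∧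
      ∀ ε s, θ ε s ≤ K := by
    refine Eventually.exists (f := atTop) (Eventually.and ?_ ?_) <;>
      simp only [eventually_all, eventually_ge_atTop, implies_true]
  have patient : ∀ᶠ δ in 𝓝 (1 : ℝ), ∀ (ε : ℤˣ) s,
      b ε + (1 - δ) / δ * (K - θ ε s) < ((ε : ℤ) : ℝ) * v ε := by
    simp only [eventually_all]
    intro ε s
    have cont : ContinuousAt (fun δ => b ε + (1 - δ) / δ * (K - θ ε s)) 1 := by
      fun_prop (disch := norm_num)
    exact cont.eventually_lt_const (by simpa using hv ε)
  filter_upwards [patient.filter_mono nhdsWithin_le_nhds, self_mem_nhdsWithin,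
    (lt_mem_nhds one_pos).filter_mono nhdsWithin_le_nhds] with δ hδ h1 h0 s w hw
  have hb0 : 0 ≤ b 1 + b (-1) := by
    have := add_le_add (hw 1) (hw (-1))
    simpa using this
  refine (selfGenerating_driftBand h0 (le_of_lt h1) hb0 hα hf hθ (fun ε s => (hδ ε s).le)
    hK).subset_sseSetIn h0.le h1
    (fun s w hw => abs_le_of_mem_driftBand (fun ε => (hδ ε s).le) hw) s fun ε => ?_
  exact add_le_add (hw ε)
    (mul_le_mul_of_nonneg_left (hθK ε s) (div_nonneg (sub_nonneg.2 (le_of_lt h1)) h0.le))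

theorem eventually_Icc_subset_sseSetIn (G : StochasticGame I S B Y) (A : Set (MixedAction B))
    {zlo zhi : ℝ} (hlo : -(G.scoreIn A (-1)) < (zlo : EReal))
    (hhi : (zhi : EReal) < G.scoreIn A 1) :
    ∀ᶠ δ in 𝓝[<] 1, ∀ s, Set.Icc zlo zhi ⊆ G.sseSetIn A δ s := by
  have below_score (ε : ℤˣ) :
      ((if ε = 1 then zhi else -zlo : ℝ) : EReal) < G.scoreIn A (ε : ℤ) := by
    rcases Int.units_eq_one_or ε with rfl | rfl
    · simpa using hhi
    · simpa using EReal.neg_lt_comm.1 hlo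
  filter_upwards [G.eventually_subset_sseSetIn A below_score] with δ hδ s w hw
  refine hδ s fun ε => ?_
  rcases Int.units_eq_one_or ε with rfl | rfl
  · simpa using hw.2
  · simpa using hw.1

end LowerBound

end StochasticGame

end

theorem mainTheorem2_general {I S B Y : Type*} [Fintype I] [DecidableEq I] [Nonempty I]
    [Fintype S] [Fintype B] [DecidableEq B] [Fintype Y] (G : StochasticGame I S B Y)
    (hG : G.IsSymmetric) (A : Set (MixedAction B)) :
    (∀ δ : ℝ, 0 < δ → δ < 1 → ∀ v ∈ ⋂ s, G.sseSetIn A δ s,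
        (v : EReal) ∈ Set.Icc (-(G.scoreIn A (-1))) (G.scoreIn A 1)) ∧
      ∀ zlo zhi : ℝ, -(G.scoreIn A (-1)) < (zlo : EReal) → (zhi : EReal) < G.scoreIn A 1 →
        ∃ δ₀ : ℝ, 0 < δ₀ ∧ δ₀ < 1 ∧ ∀ δ : ℝ, δ₀ ≤ δ → δ < 1 →
          ∀ s, Set.Icc zlo zhi ⊆ G.sseSetIn A δ s := by
  constructor
  · intro δ h0 h1 v hv
    rw [Set.mem_iInter] at hv
    have upper := StochasticGame.coe_mul_le_scoreIn hG h0.le h1 (one_mul 1) hv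
    have lower := StochasticGame.coe_mul_le_scoreIn hG h0.le h1 (l := -1) (by norm_num) hv
    exact ⟨EReal.neg_le.1 (by simpa using lower), by simpa using upper⟩
  · intro zlo zhi hlo hhi
    obtain ⟨δ₀, hδ₀, hsub⟩ :=
      mem_nhdsLT_iff_exists_Ico_subset.1 (G.eventually_Icc_subset_sseSetIn A hlo hhi)
    exact ⟨max δ₀ (1 / 2), by positivity, max_lt hδ₀ (by norm_num),
      fun δ hδ h1 => hsub ⟨(le_max_left _ _).trans hδ, h1⟩⟩

theorem mainTheorem2 {I S B Y : Type*} [Fintype I] [DecidableEq I] [Nonempty I]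
    [Fintype S] [Nonempty S] [Fintype B] [DecidableEq B] [Nonempty B] [Fintype Y]
    (G : StochasticGame I S B Y) (hG : G.IsSymmetric) :
    ((∀ δ : ℝ, 0 < δ → δ < 1 → ∀ v ∈ ⋂ s, G.sseSet δ s,
        (v : EReal) ∈ Set.Icc (-(G.kSS (-1))) (G.kSS 1)) ∧
      (∀ zlo zhi : ℝ, zlo ≤ zhi → -(G.kSS (-1)) < (zlo : EReal) → (zhi : EReal) < G.kSS 1 →
        ∃ δ₀ : ℝ, 0 < δ₀ ∧ δ₀ < 1 ∧ ∀ δ : ℝ, δ₀ ≤ δ → δ < 1 →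
          ∀ s, Set.Icc zlo zhi ⊆ G.sseSet δ s)) ∧
    ((∀ δ : ℝ, 0 < δ → δ < 1 → ∀ v ∈ ⋂ s, G.pureSseSet δ s,
        (v : EReal) ∈ Set.Icc (-(G.kSSPure (-1))) (G.kSSPure 1)) ∧
      (∀ zlo zhi : ℝ, zlo ≤ zhi → -(G.kSSPure (-1)) < (zlo : EReal) →
        (zhi : EReal) < G.kSSPure 1 →
        ∃ δ₀ : ℝ, 0 < δ₀ ∧ δ₀ < 1 ∧ ∀ δ : ℝ, δ₀ ≤ δ → δ < 1 →
          ∀ s, Set.Icc zlo zhi ⊆ G.pureSseSet δ s)) := by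
  simp only [← G.sseSetIn_univ, ← G.scoreIn_univ, ← G.sseSetIn_pure, ← G.scoreIn_pure]
  exact ⟨(mainTheorem2_general G hG _).imp_right fun h zlo zhi _ => h zlo zhi,
    (mainTheorem2_general G hG _).imp_right fun h zlo zhi _ => h zlo zhi⟩
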